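/- Let $n\ge 1$ and let $T$ be a noncrossing tree on the vertex set $[n]=\{1,\dots,n\}$, i.e. a tree with no two edges $(a,c),(b,d)$ such that $a<b<c<d$; edges are written $(i,j)$ with $i<j$. Put $m[T]=\prod_{(i,j)\in T}x_{ij}\in\mathbb{Q}[\beta][x_{ij}\mid 1\le i<j\le n]$. A reduction applied to a sum of terms $\beta^a x^d$ chooses one term divisible by $x_{ij}x_{jk}$ for some $i<j<k$, replaces one occurrence of $x_{ij}x_{jk}$ in that term by $x_{ik}(x_{ij}+x_{jk}+\beta)$, and expands. (These are the relations $x_{ij}x_{jk}=x_{ik}(x_{ij}+x_{jk}+\beta)$ of the subdivision algebra $\mathcal{S}(\beta)$.) A reduced form of $m[T]$ is a polynomial obtained from $m[T]$ by successive reductions, until no further reduction is possible. The canonical reduced form $\mathrm{Crf}_T$ of $m[T]$ is the one obtained when, in each term, the reduction is always made at the smallest vertex $j$ for which the term is divisible by some $x_{ij}x_{jk}$, $i<j<k$ (processing from front to back), and there on the topmost edges $(i,j),(j,k)$, i.e. with $i$ smallest and $k$ largest possible. One may also process from back to front, i.e. always reduce at the largest such vertex $j$, again on the topmost edges; what follows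 holds for $\mathrm{Crf}_T$ computed in either order. For a polynomial $R$ in the $x_{ij}$ let $R(t_1,\dots,t_{n-1})\in\mathbb{Q}[\beta][t_1,\dots,t_{n-1}]$ be its image under the substitution $x_{ij}=t_i$. **Theorem.** $\mathrm{Crf}_T$ is a reduced form of $m[T]$, and every reduced form $R_T$ of $m[T]$ satisfies $$R_T(t_1,\dots,t_{n-1})=\mathrm{Crf}_T(t_1,\dots,t_{n-1}).$$ In particular the reduced form of $m[T]$ becomes unique after the substitution $x_{ij}=t_i$. -/

import Mathlib

namespace SubdivisionAlgebra

/-- The pairs `(i, j)` with `i < j`, which index the variables `x_{ij}` and which are the possible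
edges of a graph on the ordered vertex set. The vertices `1, …, n` are the elements of `Fin n`. -/
abbrev Edge (n : ℕ) : Type := {e : Fin n × Fin n // e.1 < e.2}

/-- The edge `(i, j)`, `i < j`. -/
abbrev edge {n : ℕ} {i j : Fin n} (h : i < j) : Edge n := ⟨(i, j), h⟩

/-- Exponent vectors of monomials in the variables `x_{ij}`. -/
abbrev Mon (n : ℕ) : Type := Edge n →₀ ℕ

/-- The exponent vector of the single variable `x_{ij}`. -/
noncomputable abbrev var {n : ℕ} {i j : Fin n} (h : i < j) : Mon n := Finsupp.single (edge h) 1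

/-- The polynomial ring `ℚ[β][x_{ij} | i < j]`, with `β` the variable of `Polynomial ℚ`. -/
abbrev XPoly (n : ℕ) : Type := MvPolynomial (Edge n) (Polynomial ℚ)

/-- The polynomial ring `ℚ[β][t_1, …, t_{n-1}]`. -/
abbrev TPoly (n : ℕ) : Type := MvPolynomial (Fin (n - 1)) (Polynomial ℚ)

/-- The substitution `x_{ij} = t_i`. -/
noncomputable def tSubst (n : ℕ) : XPoly n →ₐ[Polynomial ℚ] TPoly n :=
  MvPolynomial.aeval fun e : Edge n =>
    MvPolynomial.X ⟨e.1.1.val, by have h := e.2; have h2 := e.1.2.isLt; omega⟩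

/-! ### Noncrossing trees -/

/-- No two edges `(a, c)` and `(b, d)` with `a < b < c < d`: the edges can be drawn as arcs above
the line carrying the vertices in increasing order, without crossings. -/
def Noncrossing {n : ℕ} (G : SimpleGraph (Fin n)) : Prop :=
  ∀ a b c d : Fin n, a < b → b < c → c < d → ¬ (G.Adj a c ∧ G.Adj b d)

open Classical in
/-- The (exponent vector of the) monomial `m[T] = ∏_{(i,j) ∈ T} x_{ij}`. -/
noncomputable def graphMon {n : ℕ} (T : SimpleGraph (Fin n)) : Mon n :=
  ∑ e : Edge n, if T.Adj e.1.1 e.1.2 then Finsupp.single e 1 else 0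

/-! ### Reduced forms -/

/-- A term `β ^ a * x ^ d`. -/
abbrev Term (n : ℕ) : Type := ℕ × Mon n

/-- The polynomial `β ^ a * x ^ d`. -/
noncomputable def Term.toPoly {n : ℕ} (s : Term n) : XPoly n :=
  MvPolynomial.monomial s.2 (Polynomial.X ^ s.1)

/-- One reduction: in one term of a sum of terms, an occurrence of `x_{ij} x_{jk}`, `i < j < k`, is
replaced by `x_{ik} (x_{ij} + x_{jk} + β)`, and the product is expanded. Here `β ^ a * x ^ m` is the
cofactor of `x_{ij} x_{jk}` in that term, and `S` consists of the other terms. -/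
inductive Step {n : ℕ} : Multiset (Term n) → Multiset (Term n) → Prop
  | reduce {i j k : Fin n} (hij : i < j) (hjk : j < k) (a : ℕ) (m : Mon n) (S : Multiset (Term n)) :
      Step ({(a, m + var hij + var hjk)} + S)
        ({(a, m + var (hij.trans hjk) + var hij), (a, m + var (hij.trans hjk) + var hjk),
          (a + 1, m + var (hij.trans hjk))} + S)

/-- `R` is a reduced form of the monomial `x ^ d`: it is the sum of the terms that are obtained from
`x ^ d` by successive reductions, and no further reduction is possible. -/
def IsReducedForm {n : ℕ} (d : Mon n) (R : XPoly n) : Prop :=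
  ∃ S : Multiset (Term n), Relation.ReflTransGen Step {(0, d)} S ∧ (∀ S', ¬ Step S S') ∧
    R = (S.map Term.toPoly).sum

/-! ### The canonical reduced form -/

/-- The `i < j` such that `(i, j)` is an edge of the graph of `x ^ d`. -/
def inNbrs {n : ℕ} (d : Mon n) (j : Fin n) : Finset (Fin n) :=
  Finset.univ.filter fun i => ∃ h : i < j, edge h ∈ d.support

/-- The `k > j` such that `(j, k)` is an edge of the graph of `x ^ d`. -/
def outNbrs {n : ℕ} (d : Mon n) (j : Fin n) : Finset (Fin n) :=
  Finset.univ.filter fun k => ∃ h : j < k, edge h ∈ d.support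

/-- The nonalternating vertices: those `j` for which there are edges `(i, j)` and `(j, k)` with
`i < j < k`, so that a reduction at `j` is possible. -/
def nonalt {n : ℕ} (d : Mon n) : Finset (Fin n) :=
  Finset.univ.filter fun j => (inNbrs d j).Nonempty ∧ (outNbrs d j).Nonempty

theorem nonempty_in {n : ℕ} {d : Mon n} {j : Fin n} (hj : j ∈ nonalt d) :
    (inNbrs d j).Nonempty := (Finset.mem_filter.1 hj).2.1

theorem nonempty_out {n : ℕ} {d : Mon n} {j : Fin n} (hj : j ∈ nonalt d) :
    (outNbrs d j).Nonempty := (Finset.mem_filter.1 hj).2.2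

/-- The other end `i` of the topmost edge `(i, j)` arriving at `j` from the left. -/
def topIn {n : ℕ} {d : Mon n} {j : Fin n} (hj : j ∈ nonalt d) : Fin n :=
  (inNbrs d j).min' (nonempty_in hj)

/-- The other end `k` of the topmost edge `(j, k)` leaving `j` to the right. -/
def topOut {n : ℕ} {d : Mon n} {j : Fin n} (hj : j ∈ nonalt d) : Fin n :=
  (outNbrs d j).max' (nonempty_out hj)

theorem topIn_spec {n : ℕ} {d : Mon n} {j : Fin n} (hj : j ∈ nonalt d) :
    ∃ h : topIn hj < j, edge h ∈ d.support :=
  (Finset.mem_filter.1 ((inNbrs d j).min'_mem (nonempty_in hj))).2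

theorem topOut_spec {n : ℕ} {d : Mon n} {j : Fin n} (hj : j ∈ nonalt d) :
    ∃ h : j < topOut hj, edge h ∈ d.support :=
  (Finset.mem_filter.1 ((outNbrs d j).max'_mem (nonempty_out hj))).2

theorem topIn_lt {n : ℕ} {d : Mon n} {j : Fin n} (hj : j ∈ nonalt d) : topIn hj < j :=
  (topIn_spec hj).1

theorem lt_topOut {n : ℕ} {d : Mon n} {j : Fin n} (hj : j ∈ nonalt d) : j < topOut hj :=
  (topOut_spec hj).1

/-- The cofactor of `x_{ij} x_{jk}` in `x ^ d`, where `(i, j)` and `(j, k)` are the topmost edges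
at `j`. -/
noncomputable def cofactor {n : ℕ} {d : Mon n} {j : Fin n} (hj : j ∈ nonalt d) : Mon n :=
  d - (var (topIn_lt hj) + var (lt_topOut hj))

theorem cofactor_add {n : ℕ} {d : Mon n} {j : Fin n} (hj : j ∈ nonalt d) :
    cofactor hj + var (topIn_lt hj) + var (lt_topOut hj) = d := by
  rw [cofactor, add_assoc]
  apply tsub_add_cancel_of_le
  have h1 := (topIn_spec hj).2
  have h2 := (topOut_spec hj).2
  have hne : edge (topIn_lt hj) ≠ edge (lt_topOut hj) := by
    intro h
    have h3 := congrArg (fun e : Edge n => e.1.1) h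
    exact (topIn_lt hj).ne h3
  rw [Finsupp.mem_support_iff] at h1 h2
  intro e
  rw [Finsupp.add_apply, Finsupp.single_apply, Finsupp.single_apply]
  by_cases he : edge (topIn_lt hj) = e
  · rw [if_pos he, if_neg (fun h => hne (he.trans h.symm)), ← he]
    omega
  · rw [if_neg he]
    by_cases he' : edge (lt_topOut hj) = e
    · rw [if_pos he', ← he']
      omega
    · rw [if_neg he']
      omega

/-- A size that every reduction makes smaller: an edge `(i, j)` counts `n - (j - i)`. -/
noncomputable def weight {n : ℕ} (d : Mon n) : ℕ :=
  d.sum fun e c => c * (n - (e.1.2.val - e.1.1.val))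

theorem weight_add {n : ℕ} (d d' : Mon n) : weight (d + d') = weight d + weight d' :=
  Finsupp.sum_add_index' (fun _ => zero_mul _) (fun _ _ _ => add_mul _ _ _)

theorem weight_var {n : ℕ} {i j : Fin n} (h : i < j) : weight (var h) = n - (j.val - i.val) := by
  rw [weight, Finsupp.sum_single_index (zero_mul _), one_mul]

theorem weight_cofactor {n : ℕ} {d : Mon n} {j : Fin n} (hj : j ∈ nonalt d) :
    weight (cofactor hj) + (n - (j.val - (topIn hj).val)) + (n - ((topOut hj).val - j.val))
      = weight d := by
  conv_rhs => rw [← cofactor_add hj]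
  rw [weight_add, weight_add, weight_var, weight_var]

/-- The result of reducing `x ^ d` completely, where each reduction is made at the vertex that
`pick` selects among the nonalternating ones, and on the topmost edges there. -/
noncomputable def topReduce {n : ℕ} (pick : ∀ s : Finset (Fin n), s.Nonempty → Fin n)
    (hpick : ∀ s h, pick s h ∈ s) (d : Mon n) : XPoly n :=
  if h : (nonalt d).Nonempty then
    have hj := hpick _ h
    topReduce pick hpick
        (cofactor hj + var ((topIn_lt hj).trans (lt_topOut hj)) + var (topIn_lt hj))
      + topReduce pick hpick
        (cofactor hj + var ((topIn_lt hj).trans (lt_topOut hj)) + var (lt_topOut hj))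
      + MvPolynomial.C Polynomial.X * topReduce pick hpick
        (cofactor hj + var ((topIn_lt hj).trans (lt_topOut hj)))
  else MvPolynomial.monomial d 1
termination_by weight d
decreasing_by
  all_goals
    have hw := weight_cofactor hj
    have h1 : (topIn hj).val < (pick _ h).val := topIn_lt hj
    have h2 : (pick _ h).val < (topOut hj).val := lt_topOut hj
    have _h3 := (topOut hj).isLt
    simp only [weight_add, weight_var]
    omega

/-- The canonical reduced form of `m[T]`, with the vertices processed from front to back: each
reduction is made at the smallest nonalternating vertex, on the topmost edges there. -/
noncomputable def crf {n : ℕ} (T : SimpleGraph (Fin n)) : XPoly n :=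
  topReduce (fun s h => s.min' h) (fun s h => s.min'_mem h) (graphMon T)

/-- The canonical reduced form of `m[T]`, with the vertices processed from back to front: each
reduction is made at the largest nonalternating vertex, on the topmost edges there. -/
noncomputable def crfBack {n : ℕ} (T : SimpleGraph (Fin n)) : XPoly n :=
  topReduce (fun s h => s.max' h) (fun s h => s.max'_mem h) (graphMon T)

end SubdivisionAlgebra

namespace SubdivisionAlgebra

/-! Substituting `β ∑_{m ≥ 1} (p_i ⋯ p_{j-1}) ^ m` for `x_{ij}` respects the relations of the
subdivision algebra (`smul_geomSeries_relation`), so all reduced forms of one monomial have the same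
image under `seriesSubst`. It remains to recover `R(t)` from that image.

An exponent in the image is a function on positions, a sum of multiples of indicators of intervals
`[i, j)`. In an irreducible term no vertex is both a start and an end of an edge, so at each
position all intervals jump in the same direction and no jumps cancel. Recording only the upward
jumps (`ascents`) is therefore additive on the exponents of that term, and pushing exponents forward
along `ascents` is multiplicative there; it turns the series of `x_{ij}` into `β ∑_{m ≥ 1} s_i ^ m`,
which forgets `j` (`pushforward_seriesSubst_monomial`). The pushforward is one linear map, the same
for all terms, so it sends the invariant to `R(t)` evaluated at `t_i = β ∑_{m ≥ 1} s_i ^ m`. These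
series are algebraically independent (`aeval_geomSeries_injective`), which determines `R(t)`. -/

/-! ### Pushing power series forward along a map of exponents -/

/-- The power series obtained by replacing each exponent `f` by `φ f`, for `φ` with finite
fibers. -/
noncomputable def pushforward {σ τ R : Type*} [CommSemiring R] (φ : (σ →₀ ℕ) → (τ →₀ ℕ))
    (hφ : ∀ g, (φ ⁻¹' {g}).Finite) : MvPowerSeries σ R →ₗ[R] MvPowerSeries τ R where
  toFun F := fun g => ∑ f ∈ (hφ g).toFinset, MvPowerSeries.coeff f F
  map_add' F G := by
    funext g
    exact Finset.sum_add_distrib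
  map_smul' c F := by
    funext g
    exact (Finset.mul_sum _ _ _).symm

theorem coeff_pushforward {σ τ R : Type*} [CommSemiring R] (φ : (σ →₀ ℕ) → (τ →₀ ℕ))
    (hφ : ∀ g, (φ ⁻¹' {g}).Finite) (F : MvPowerSeries σ R) (g : τ →₀ ℕ) :
    MvPowerSeries.coeff g (pushforward φ hφ F)
      = ∑ f ∈ (hφ g).toFinset, MvPowerSeries.coeff f F := rfl

/-- All exponents of `F` lie in `S`. -/
def SupportedIn {σ R : Type*} [CommSemiring R] (S : AddSubmonoid (σ →₀ ℕ))
    (F : MvPowerSeries σ R) : Prop :=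
  ∀ f, MvPowerSeries.coeff f F ≠ 0 → f ∈ S

theorem SupportedIn.mul {σ R : Type*} [CommSemiring R] {S : AddSubmonoid (σ →₀ ℕ)}
    {F G : MvPowerSeries σ R} (hF : SupportedIn S F) (hG : SupportedIn S G) :
    SupportedIn S (F * G) := by
  classical
  intro f hf
  rw [MvPowerSeries.coeff_mul] at hf
  obtain ⟨x, hx, hne⟩ := Finset.exists_ne_zero_of_sum_ne_zero hf
  rw [← Finset.HasAntidiagonal.mem_antidiagonal.1 hx]
  exact S.add_mem (hF _ (left_ne_zero_of_mul hne)) (hG _ (right_ne_zero_of_mul hne))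

theorem SupportedIn.one {σ R : Type*} [CommSemiring R] (S : AddSubmonoid (σ →₀ ℕ)) :
    SupportedIn S (1 : MvPowerSeries σ R) := by
  classical
  intro f hf
  rw [MvPowerSeries.coeff_one] at hf
  rw [(ite_ne_right_iff.1 hf).1]
  exact S.zero_mem

theorem SupportedIn.smul {σ R : Type*} [CommSemiring R] {S : AddSubmonoid (σ →₀ ℕ)}
    {F : MvPowerSeries σ R} (hF : SupportedIn S F) (c : R) : SupportedIn S (c • F) := by
  intro f hf
  rw [map_smul, smul_eq_mul] at hf
  exact hF f (right_ne_zero_of_mul hf)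

/-- Additivity of `φ` is needed only on `S`: a pair of exponents outside `S` contributes zero to the
product. -/
theorem pushforward_mul {σ τ R : Type*} [CommSemiring R] (φ : (σ →₀ ℕ) → (τ →₀ ℕ))
    (hφ : ∀ g, (φ ⁻¹' {g}).Finite) {S : AddSubmonoid (σ →₀ ℕ)}
    (hadd : ∀ a ∈ S, ∀ b ∈ S, φ (a + b) = φ a + φ b) {F G : MvPowerSeries σ R}
    (hF : SupportedIn S F) (hG : SupportedIn S G) :
    pushforward φ hφ (F * G) = pushforward φ hφ F * pushforward φ hφ G := by
  classical
  ext g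
  simp only [coeff_pushforward, MvPowerSeries.coeff_mul, Finset.sum_mul_sum, ← Finset.sum_product']
  rw [Finset.sum_sigma', Finset.sum_sigma']
  -- Only nonzero terms are matched, so both exponents are known to lie in `S`.
  refine Finset.sum_bij_ne_zero (fun p _ _ => ⟨(φ p.2.1, φ p.2.2), p.2⟩) ?_ ?_ ?_ ?_
  · rintro ⟨f, a, b⟩ h hne
    have ha : a ∈ S := hF _ (left_ne_zero_of_mul hne)
    have hb : b ∈ S := hG _ (right_ne_zero_of_mul hne)
    simp only [Finset.mem_sigma, Set.Finite.mem_toFinset, Set.mem_preimage, Set.mem_singleton_iff,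
      Finset.HasAntidiagonal.mem_antidiagonal, Finset.mem_product] at h ⊢
    refine ⟨?_, trivial, trivial⟩
    rw [← hadd _ ha _ hb, h.2, h.1]
  · rintro ⟨f, x⟩ h _ ⟨f', x'⟩ h' _ heq
    simp only [Finset.mem_sigma, Finset.HasAntidiagonal.mem_antidiagonal] at h h'
    obtain rfl : x = x' := by simpa using (Sigma.mk.inj_iff.1 heq).2
    obtain rfl : f = f' := h.2.symm.trans h'.2
    rfl
  · rintro ⟨⟨g₁, g₂⟩, a, b⟩ h hne
    have ha : a ∈ S := hF _ (left_ne_zero_of_mul hne)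
    have hb : b ∈ S := hG _ (right_ne_zero_of_mul hne)
    simp only [Finset.mem_sigma, Set.Finite.mem_toFinset, Set.mem_preimage, Set.mem_singleton_iff,
      Finset.HasAntidiagonal.mem_antidiagonal, Finset.mem_product] at h
    obtain ⟨h, rfl, rfl⟩ := h
    refine ⟨⟨a + b, a, b⟩, ?_, hne, rfl⟩
    simp only [Finset.mem_sigma, Set.Finite.mem_toFinset, Set.mem_preimage, Set.mem_singleton_iff,
      Finset.HasAntidiagonal.mem_antidiagonal, and_true]
    rw [hadd _ ha _ hb, h]
  · intros
    rfl

theorem pushforward_one {σ τ R : Type*} [CommSemiring R] (φ : (σ →₀ ℕ) → (τ →₀ ℕ))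
    (hφ : ∀ g, (φ ⁻¹' {g}).Finite) (h0 : φ 0 = 0) :
    pushforward φ hφ (1 : MvPowerSeries σ R) = 1 := by
  classical
  ext g
  simp only [coeff_pushforward, MvPowerSeries.coeff_one]
  rw [Finset.sum_ite_eq']
  simp only [Set.Finite.mem_toFinset, Set.mem_preimage, Set.mem_singleton_iff, h0, eq_comm]

theorem pushforward_prod_pow {ι σ τ R : Type*} [CommSemiring R] (φ : (σ →₀ ℕ) → (τ →₀ ℕ))
    (hφ : ∀ g, (φ ⁻¹' {g}).Finite) (h0 : φ 0 = 0) {S : AddSubmonoid (σ →₀ ℕ)}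
    (hadd : ∀ a ∈ S, ∀ b ∈ S, φ (a + b) = φ a + φ b) (s : Finset ι) (c : ι → ℕ)
    (F : ι → MvPowerSeries σ R) (hF : ∀ i ∈ s, SupportedIn S (F i)) :
    pushforward φ hφ (∏ i ∈ s, F i ^ c i) = ∏ i ∈ s, pushforward φ hφ (F i) ^ c i := by
  classical
  have hpow : ∀ G : MvPowerSeries σ R, SupportedIn S G → ∀ m : ℕ,
      SupportedIn S (G ^ m) ∧ pushforward φ hφ (G ^ m) = pushforward φ hφ G ^ m := by
    intro G hG m
    induction m with
    | zero => simpa using ⟨SupportedIn.one S, pushforward_one φ hφ h0⟩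
    | succ m ih =>
      rw [pow_succ, pow_succ, pushforward_mul φ hφ hadd ih.1 hG, ih.2]
      exact ⟨ih.1.mul hG, rfl⟩
  -- The support condition is carried through the induction because `pushforward_mul` requires it of
  -- both factors.
  suffices h : SupportedIn S (∏ i ∈ s, F i ^ c i) ∧
      pushforward φ hφ (∏ i ∈ s, F i ^ c i) = ∏ i ∈ s, pushforward φ hφ (F i) ^ c i from h.2
  induction s using Finset.induction_on with
  | empty => simpa using ⟨SupportedIn.one S, pushforward_one φ hφ h0⟩
  | insert i s hi ih =>
    have ih := ih fun j hj => hF j (Finset.mem_insert_of_mem hj)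
    have h1 := hpow (F i) (hF i (Finset.mem_insert_self i s)) (c i)
    rw [Finset.prod_insert hi, Finset.prod_insert hi, pushforward_mul φ hφ hadd h1.1 ih.1, h1.2,
      ih.2]
    exact ⟨h1.1.mul ih.1, rfl⟩

/-! ### Geometric series -/

open Classical in
/-- The power series `∑_{m ≥ 1} x ^ (m u)`. -/
noncomputable def geomSeries {σ : Type*} (R : Type*) [CommRing R] (u : σ →₀ ℕ) :
    MvPowerSeries σ R :=
  fun f => if ∃ m : ℕ, 0 < m ∧ f = m • u then 1 else 0

open Classical in
theorem coeff_geomSeries {σ R : Type*} [CommRing R] (u f : σ →₀ ℕ) :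
    MvPowerSeries.coeff f (geomSeries R u) = if ∃ m : ℕ, 0 < m ∧ f = m • u then 1 else 0 := rfl

theorem supportedIn_geomSeries {σ R : Type*} [CommRing R] {S : AddSubmonoid (σ →₀ ℕ)}
    {u : σ →₀ ℕ} (hu : u ∈ S) : SupportedIn S (geomSeries R u) := by
  classical
  intro f hf
  rw [coeff_geomSeries] at hf
  obtain ⟨m, -, rfl⟩ := (ite_ne_right_iff.1 hf).1
  exact S.nsmul_mem hu m

theorem geomSeries_eq {σ R : Type*} [CommRing R] {u : σ →₀ ℕ} (hu : u ≠ 0) :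
    geomSeries R u = MvPowerSeries.monomial u 1 * (1 + geomSeries R u) := by
  classical
  ext f
  rw [MvPowerSeries.coeff_monomial_mul, one_mul, map_add, MvPowerSeries.coeff_one,
    coeff_geomSeries, coeff_geomSeries]
  by_cases hf : u ≤ f
  · rw [if_pos hf]
    obtain ⟨f, rfl⟩ := exists_add_of_le hf
    rw [add_tsub_cancel_left]
    by_cases h0 : f = 0
    · subst h0
      rw [if_pos ⟨1, one_pos, by simp⟩, if_pos rfl, if_neg, add_zero]
      rintro ⟨m, hm, h⟩
      rcases smul_eq_zero.1 h.symm with h | h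
      · omega
      · exact hu h
    · rw [if_neg h0, zero_add]
      refine if_congr ⟨?_, ?_⟩ rfl rfl
      · rintro ⟨m, hm, h⟩
        obtain ⟨m, rfl⟩ := Nat.exists_eq_succ_of_ne_zero hm.ne'
        rw [succ_nsmul', add_right_inj] at h
        refine ⟨m, Nat.pos_of_ne_zero fun hm0 => h0 ?_, h⟩
        rw [h, hm0, zero_smul]
      · rintro ⟨m, hm, rfl⟩
        exact ⟨m + 1, by omega, (succ_nsmul' u m).symm⟩
  · rw [if_neg hf, if_neg]
    rintro ⟨m, hm, rfl⟩
    exact hf (le_smul_of_one_le_left zero_le hm)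

theorem isUnit_one_sub_monomial {σ R : Type*} [CommRing R] {u : σ →₀ ℕ} (hu : u ≠ 0) :
    IsUnit (1 - MvPowerSeries.monomial u (1 : R)) :=
  IsUnit.of_mul_eq_one (1 + geomSeries R u) (by linear_combination geomSeries_eq (R := R) hu)

/-- With `p`, `q` the monomials of `u`, `v`, the series are `p/(1-p)`, `q/(1-q)` and `pq/(1-pq)`.
After clearing denominators, what remains is `(1-q)p + (1-p)q + (1-p)(1-q) = 1 - pq`. -/
theorem smul_geomSeries_relation {σ R : Type*} [CommRing R] (b : R) {u v : σ →₀ ℕ} (hu : u ≠ 0)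
    (hv : v ≠ 0) :
    (b • geomSeries R u) * (b • geomSeries R v)
      = (b • geomSeries R (u + v)) *
        (b • geomSeries R u + b • geomSeries R v + algebraMap R _ b) := by
  have huv : u + v ≠ 0 := fun h => hu (add_eq_zero.1 h).1
  have h1 := geomSeries_eq (R := R) hu
  have h2 := geomSeries_eq (R := R) hv
  have h3 := geomSeries_eq (R := R) huv
  have hm : MvPowerSeries.monomial (u + v) (1 : R)
      = MvPowerSeries.monomial u 1 * MvPowerSeries.monomial v 1 := by
    rw [MvPowerSeries.monomial_mul_monomial, one_mul]
  have hU := isUnit_one_sub_monomial (R := R) hu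
  have hV := isUnit_one_sub_monomial (R := R) hv
  have hW := isUnit_one_sub_monomial (R := R) huv
  rw [hm] at h3 hW
  simp only [Algebra.smul_def]
  generalize algebraMap R (MvPowerSeries σ R) b = B
  generalize geomSeries R u = x at *
  generalize geomSeries R v = y at *
  generalize geomSeries R (u + v) = z at *
  generalize MvPowerSeries.monomial u (1 : R) = p at *
  generalize MvPowerSeries.monomial v (1 : R) = q at *
  have e1 : (1 - p) * x = p := by linear_combination h1
  have e2 : (1 - q) * y = q := by linear_combination h2
  have e3 : (1 - p * q) * z = p * q := by linear_combination h3
  refine ((hU.mul hV).mul hW).mul_left_cancel ?_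
  calc (1 - p) * (1 - q) * (1 - p * q) * (B * x * (B * y))
      = B ^ 2 * (1 - p * q) * ((1 - p) * x) * ((1 - q) * y) := by ring
    _ = B ^ 2 * (p * q) *
        ((1 - q) * p + (1 - p) * q + (1 - p) * (1 - q)) := by rw [e1, e2]; ring
    _ = B ^ 2 * ((1 - p * q) * z) *
        ((1 - q) * ((1 - p) * x) + (1 - p) * ((1 - q) * y) + (1 - p) * (1 - q)) := by
          rw [e1, e2, e3]
    _ = _ := by ring

/-- Since `φ u ≠ 0`, distinct multiples of `u` have distinct images, so no coefficients are merged.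
-/
theorem pushforward_geomSeries {σ τ R : Type*} [CommRing R] (φ : (σ →₀ ℕ) → (τ →₀ ℕ))
    (hφ : ∀ g, (φ ⁻¹' {g}).Finite) {u : σ →₀ ℕ} (hu : φ u ≠ 0)
    (hmul : ∀ m : ℕ, φ (m • u) = m • φ u) :
    pushforward φ hφ (geomSeries R u) = geomSeries R (φ u) := by
  classical
  ext g
  rw [coeff_pushforward, coeff_geomSeries]
  simp only [coeff_geomSeries]
  by_cases hg : ∃ m : ℕ, 0 < m ∧ g = m • φ u
  · rw [if_pos hg]
    obtain ⟨m, hm, rfl⟩ := hg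
    rw [Finset.sum_eq_single (m • u), if_pos ⟨m, hm, rfl⟩]
    · intro f hf hne
      rw [if_neg]
      rintro ⟨l, -, rfl⟩
      simp only [Set.Finite.mem_toFinset, Set.mem_preimage, Set.mem_singleton_iff, hmul] at hf
      obtain ⟨a, ha⟩ := Finsupp.ne_iff.1 hu
      have h := DFunLike.congr_fun hf a
      simp only [Finsupp.smul_apply, smul_eq_mul] at h
      rw [Nat.eq_of_mul_eq_mul_right (Nat.pos_of_ne_zero ha) h] at hne
      exact hne rfl
    · intro h
      exact absurd (by simp [hmul]) h
  · rw [if_neg hg]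
    refine Finset.sum_eq_zero fun f hf => if_neg ?_
    rintro ⟨m, hm, rfl⟩
    simp only [Set.Finite.mem_toFinset, Set.mem_preimage, Set.mem_singleton_iff, hmul] at hf
    exact hg ⟨m, hm, hf.symm⟩

/-- The series `b ∑_{m ≥ 1} s_i ^ m` are algebraically independent. -/
theorem aeval_geomSeries_injective {σ R : Type*} [CommRing R] [IsDomain R] {b : R}
    (hb : b ≠ 0) :
    Function.Injective (MvPolynomial.aeval (R := R)
      fun i : σ => b • geomSeries R (Finsupp.single i 1)) := by
  classical
  rw [injective_iff_map_eq_zero]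
  intro p hp
  by_contra hne
  obtain ⟨d₀, hd₀⟩ := p.support.exists_minimal (MvPolynomial.support_nonempty.2 hne)
  -- Each monomial `d` is sent to a series with lowest term a nonzero multiple of `x ^ d`, because
  -- each variable goes to `x_i` times a series with constant term `b`.
  have key : ∀ d : σ →₀ ℕ, ∃ V : MvPowerSeries σ R, MvPowerSeries.constantCoeff V ≠ 0 ∧
      MvPolynomial.aeval (R := R) (fun i : σ => b • geomSeries R (Finsupp.single i 1))
        (MvPolynomial.monomial d 1) = MvPowerSeries.monomial d 1 * V := by
    intro d
    refine ⟨d.prod fun i m => (b • (1 + geomSeries R (Finsupp.single i 1))) ^ m, ?_, ?_⟩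
    · rw [Finsupp.prod, map_prod]
      refine Finset.prod_ne_zero_iff.2 fun i _ => ?_
      rw [map_pow]
      refine pow_ne_zero _ ?_
      rw [← MvPowerSeries.coeff_zero_eq_constantCoeff_apply, map_smul, map_add,
        coeff_geomSeries, if_neg, add_zero, MvPowerSeries.coeff_zero_one, smul_eq_mul, mul_one]
      · exact hb
      · rintro ⟨m, hm, h⟩
        have := DFunLike.congr_fun h i
        simp at this
        omega
    · rw [MvPolynomial.aeval_monomial, map_one, one_mul]
      have : MvPowerSeries.monomial d (1 : R) = d.prod fun i m => MvPowerSeries.X i ^ m := by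
        rw [← MvPolynomial.coe_monomial, MvPolynomial.monomial_eq, map_one, one_mul,
          ← MvPolynomial.coeToMvPowerSeries.ringHom_apply, Finsupp.prod, map_prod]
        simp [Finsupp.prod]
      rw [this, ← Finsupp.prod_mul]
      refine Finsupp.prod_congr fun i _ => ?_
      rw [← mul_pow, mul_smul_comm, MvPowerSeries.X,
        ← geomSeries_eq (Finsupp.single_ne_zero.2 one_ne_zero)]
  have h0 : MvPowerSeries.coeff d₀ (MvPolynomial.aeval (R := R)
      (fun i : σ => b • geomSeries R (Finsupp.single i 1)) p) = 0 := by rw [hp, map_zero]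
  -- A monomial `d` contributes to the coefficient at `d₀` only if `d ≤ d₀`; minimality of `d₀`
  -- leaves `d₀` alone.
  rw [p.as_sum, map_sum, map_sum, Finset.sum_eq_single d₀] at h0
  · obtain ⟨V, hV, h⟩ := key d₀
    rw [← mul_one (p.coeff d₀), ← smul_eq_mul, ← MvPolynomial.smul_monomial, map_smul, h, map_smul,
      MvPowerSeries.coeff_monomial_mul, if_pos le_rfl, tsub_self, one_mul, smul_eq_mul,
      MvPowerSeries.coeff_zero_eq_constantCoeff_apply] at h0
    exact mul_ne_zero (MvPolynomial.mem_support_iff.1 hd₀.1) hV h0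
  · intro d hd hdne
    obtain ⟨V, hV, h⟩ := key d
    rw [← mul_one (p.coeff d), ← smul_eq_mul, ← MvPolynomial.smul_monomial, map_smul, h, map_smul,
      MvPowerSeries.coeff_monomial_mul, if_neg, smul_zero]
    exact fun hle => hdne (le_antisymm hle (hd₀.2 hd hle))
  · exact fun h => absurd hd₀.1 h

/-! ### Reductions lead to reduced forms -/

theorem Step.add_right {n : ℕ} {S S' : Multiset (Term n)} (h : Step S S')
    (U : Multiset (Term n)) : Step (S + U) (S' + U) := by
  cases h with
  | reduce hij hjk a m S =>
    rw [Multiset.add_assoc, Multiset.add_assoc]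
    exact Step.reduce hij hjk a m (S + U)

theorem reduces_add {n : ℕ} {S S' U U' : Multiset (Term n)}
    (h : Relation.ReflTransGen Step S S') (h' : Relation.ReflTransGen Step U U') :
    Relation.ReflTransGen Step (S + U) (S' + U') := by
  refine (h.lift (fun V => V + U) fun _ _ hs => hs.add_right U).trans ?_
  refine h'.lift (fun V => S' + V) fun V W hs => ?_
  change Step (S' + V) (S' + W)
  rw [add_comm S' V, add_comm S' W]
  exact hs.add_right S'

theorem nonalt_add_var_add_var {n : ℕ} {i j k : Fin n} (hij : i < j) (hjk : j < k) (m : Mon n) :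
    j ∈ nonalt (m + var hij + var hjk) := by
  refine Finset.mem_filter.2 ⟨Finset.mem_univ _, ⟨i, ?_⟩, ⟨k, ?_⟩⟩
  · exact Finset.mem_filter.2 ⟨Finset.mem_univ _, hij, by simp⟩
  · exact Finset.mem_filter.2 ⟨Finset.mem_univ _, hjk, by simp⟩

theorem step_cofactor {n : ℕ} {d : Mon n} {j : Fin n} (hj : j ∈ nonalt d) (a : ℕ)
    (S : Multiset (Term n)) :
    Step ({(a, d)} + S)
      ({(a, cofactor hj + var ((topIn_lt hj).trans (lt_topOut hj)) + var (topIn_lt hj)),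
        (a, cofactor hj + var ((topIn_lt hj).trans (lt_topOut hj)) + var (lt_topOut hj)),
        (a + 1, cofactor hj + var ((topIn_lt hj).trans (lt_topOut hj)))} + S) := by
  have h := Step.reduce (topIn_lt hj) (lt_topOut hj) a (cofactor hj) S
  rwa [cofactor_add hj] at h

theorem irreducible_iff {n : ℕ} (S : Multiset (Term n)) :
    (∀ S', ¬ Step S S') ↔ ∀ s ∈ S, nonalt s.2 = ∅ := by
  constructor
  · rintro h ⟨a, d⟩ hs
    by_contra hne
    obtain ⟨j, hj⟩ := Finset.nonempty_iff_ne_empty.2 hne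
    obtain ⟨U, rfl⟩ := Multiset.exists_cons_of_mem hs
    rw [← Multiset.singleton_add] at h
    exact h _ (step_cofactor hj a U)
  · rintro h S' ⟨hij, hjk, a, m, U⟩
    have := nonalt_add_var_add_var hij hjk m
    rw [h (a, _) (Multiset.mem_add.2 (Or.inl (Multiset.mem_singleton_self _)))] at this
    exact absurd this (Finset.notMem_empty _)

theorem exists_reduces_topReduce {n : ℕ} (pick : ∀ s : Finset (Fin n), s.Nonempty → Fin n)
    (hpick : ∀ s h, pick s h ∈ s) (d : Mon n) (a : ℕ) :
    ∃ S : Multiset (Term n), Relation.ReflTransGen Step {(a, d)} S ∧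
      (∀ s ∈ S, nonalt s.2 = ∅) ∧
      (S.map Term.toPoly).sum = MvPolynomial.C (Polynomial.X ^ a) * topReduce pick hpick d := by
  fun_induction topReduce pick hpick d generalizing a with
  | case1 d h hj ih1 ih2 ih3 =>
    obtain ⟨S₁, r₁, i₁, e₁⟩ := ih1 a
    obtain ⟨S₂, r₂, i₂, e₂⟩ := ih2 a
    -- The third term of a reduction carries an extra `β`, which is why `a` is generalized.
    obtain ⟨S₃, r₃, i₃, e₃⟩ := ih3 (a + 1)
    refine ⟨S₁ + (S₂ + S₃), ?_, ?_, ?_⟩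
    · refine Relation.ReflTransGen.head ?_ (reduces_add r₁ (reduces_add r₂ r₃))
      exact step_cofactor hj a 0
    · intro s hs
      rcases Multiset.mem_add.1 hs with hs | hs
      · exact i₁ s hs
      · rcases Multiset.mem_add.1 hs with hs | hs
        · exact i₂ s hs
        · exact i₃ s hs
    · rw [Multiset.map_add, Multiset.sum_add, Multiset.map_add, Multiset.sum_add, e₁, e₂, e₃,
        pow_succ, MvPolynomial.C_mul]
      ring
  | case2 d h =>
    refine ⟨{(a, d)}, .refl, ?_, ?_⟩
    · intro s hs
      rw [Multiset.mem_singleton.1 hs]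
      exact Finset.not_nonempty_iff_eq_empty.1 h
    · rw [Multiset.map_singleton, Multiset.sum_singleton, Term.toPoly,
        MvPolynomial.C_mul_monomial, mul_one]

theorem isReducedForm_topReduce {n : ℕ} (pick : ∀ s : Finset (Fin n), s.Nonempty → Fin n)
    (hpick : ∀ s h, pick s h ∈ s) (d : Mon n) : IsReducedForm d (topReduce pick hpick d) := by
  obtain ⟨S, hr, hi, he⟩ := exists_reduces_topReduce pick hpick d 0
  refine ⟨S, hr, (irreducible_iff S).2 hi, ?_⟩
  rw [he, pow_zero, map_one, one_mul]

/-! ### Intervals and their ends -/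

/-- The indicator function of the interval `[i, j)`. -/
noncomputable def interval (N i j : ℕ) : Fin N →₀ ℕ :=
  Finsupp.equivFunOnFinite.symm fun l => if i ≤ l.val ∧ l.val < j then 1 else 0

theorem interval_apply (N i j : ℕ) (l : Fin N) :
    interval N i j l = if i ≤ l.val ∧ l.val < j then 1 else 0 := rfl

theorem interval_add (N : ℕ) {i j k : ℕ} (hij : i < j) (hjk : j < k) :
    interval N i j + interval N j k = interval N i k := by
  ext l
  simp only [Finsupp.add_apply, interval_apply]
  split_ifs <;> omega

theorem interval_ne_zero {N i j : ℕ} (hi : i < N) (hij : i < j) : interval N i j ≠ 0 := by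
  intro h
  have := DFunLike.congr_fun h ⟨i, hi⟩
  simp [interval_apply, hij] at this

/-- The value of `f` just before `l`, and `0` if there is none. -/
def prevValue {N : ℕ} (f : Fin N →₀ ℕ) (l : Fin N) : ℕ :=
  if l.val = 0 then 0 else f ⟨l.val - 1, by omega⟩

theorem prevValue_add {N : ℕ} (f g : Fin N →₀ ℕ) (l : Fin N) :
    prevValue (f + g) l = prevValue f l + prevValue g l := by
  unfold prevValue
  split_ifs <;> simp

/-- The upward jumps of `f`. -/
noncomputable def ascents {N : ℕ} (f : Fin N →₀ ℕ) : Fin N →₀ ℕ :=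
  Finsupp.equivFunOnFinite.symm fun l => f l - prevValue f l

theorem ascents_apply {N : ℕ} (f : Fin N →₀ ℕ) (l : Fin N) :
    ascents f l = f l - prevValue f l := rfl

/-- A value is at most the sum of the upward jumps up to it. The crude bound is enough to make the
fibers of `ascents` finite. -/
theorem le_of_ascents {N : ℕ} (f : Fin N →₀ ℕ) (m : ℕ) (hm : m < N) :
    f ⟨m, hm⟩ ≤ (m + 1) * ∑ l, ascents f l := by
  have h (l : Fin N) : f l ≤ prevValue f l + ∑ l, ascents f l := by
    have h1 := Finset.single_le_sum (f := fun l => ascents f l) (fun _ _ => Nat.zero_le _)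
      (Finset.mem_univ l)
    have h2 := ascents_apply f l
    omega
  induction m with
  | zero => simpa [prevValue] using h ⟨0, hm⟩
  | succ m ih =>
    have h1 := h ⟨m + 1, hm⟩
    have h2 := ih (by omega)
    simp only [prevValue, Nat.add_sub_cancel, Nat.add_eq_zero_iff, one_ne_zero, and_false,
      if_false] at h1
    rw [add_mul _ 1, one_mul]
    omega

theorem finite_ascents_fiber {N : ℕ} (g : Fin N →₀ ℕ) : (ascents ⁻¹' {g}).Finite := by
  refine (Set.finite_Iic (Finsupp.equivFunOnFinite.symm
    fun l : Fin N => (l.val + 1) * ∑ l, g l)).subset ?_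
  rintro f rfl l
  exact le_of_ascents f l.val l.isLt

/-- The functions whose upward jumps are only at elements of `I` and whose downward jumps are not
at elements of `I`. -/
def jumpCone {N : ℕ} (I : Set (Fin N)) : AddSubmonoid (Fin N →₀ ℕ) where
  carrier := {f | ∀ l, (l ∈ I → prevValue f l ≤ f l) ∧ (l ∉ I → f l ≤ prevValue f l)}
  zero_mem' := fun l => ⟨fun _ => by simp [prevValue], fun _ => by simp⟩
  add_mem' := by
    intro f g hf hg l
    rw [prevValue_add, Finsupp.add_apply]
    exact ⟨fun h => add_le_add ((hf l).1 h) ((hg l).1 h),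
      fun h => add_le_add ((hf l).2 h) ((hg l).2 h)⟩

/-- Truncated subtraction is additive when the differences have the same sign: on `I` nothing is
truncated, off `I` every difference is truncated to zero. -/
theorem ascents_add {N : ℕ} {I : Set (Fin N)} {f g : Fin N →₀ ℕ} (hf : f ∈ jumpCone I)
    (hg : g ∈ jumpCone I) : ascents (f + g) = ascents f + ascents g := by
  ext l
  simp only [ascents_apply, prevValue_add, Finsupp.add_apply]
  have h1 := hf l
  have h2 := hg l
  by_cases hl : l ∈ I
  · have := h1.1 hl
    have := h2.1 hl
    omega
  · have := h1.2 hl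
    have := h2.2 hl
    omega

theorem ascents_zero {N : ℕ} : ascents (0 : Fin N →₀ ℕ) = 0 := by
  ext l
  simp [ascents_apply]

/-- The ends are natural numbers because `j = N` is allowed: the downward jump then lies outside the
range and `hj` is vacuous. -/
theorem interval_mem_jumpCone {N i j : ℕ} {I : Set (Fin N)}
    (hi : ∀ l : Fin N, l.val = i → l ∈ I) (hj : ∀ l : Fin N, l.val = j → l ∉ I) :
    interval N i j ∈ jumpCone I := by
  intro l
  simp only [prevValue, interval_apply]
  refine ⟨fun hl => ?_, fun hl => ?_⟩
  · have : l.val ≠ j := fun h => hj l h hl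
    split_ifs <;> omega
  · have : l.val ≠ i := fun h => hl (hi l h)
    split_ifs <;> omega

theorem ascents_nsmul_interval {N i j : ℕ} (hi : i < N) (hij : i < j) (m : ℕ) :
    ascents (m • interval N i j) = m • Finsupp.single ⟨i, hi⟩ 1 := by
  ext l
  simp only [ascents_apply, prevValue, Finsupp.smul_apply, interval_apply, Finsupp.single_apply,
    Fin.ext_iff, smul_eq_mul]
  split_ifs <;> omega

theorem ascents_interval {N i j : ℕ} (hi : i < N) (hij : i < j) :
    ascents (interval N i j) = Finsupp.single ⟨i, hi⟩ 1 := by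
  simpa using ascents_nsmul_interval hi hij 1

/-! ### The invariant of reductions -/

theorem Edge.fst_lt {n : ℕ} (e : Edge n) : e.1.1.val < n - 1 := by
  have h := e.2
  have h2 := e.1.2.isLt
  omega

/-- The homomorphism `x_{ij} ↦ β ∑_{m ≥ 1} (p_i ⋯ p_{j-1}) ^ m`. It respects the relations of the
subdivision algebra. -/
noncomputable def seriesSubst (n : ℕ) :
    XPoly n →ₐ[Polynomial ℚ] MvPowerSeries (Fin (n - 1)) (Polynomial ℚ) :=
  MvPolynomial.aeval fun e : Edge n =>
    (Polynomial.X : Polynomial ℚ) • geomSeries (Polynomial ℚ) (interval (n - 1) e.1.1 e.1.2)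

theorem toPoly_step {n : ℕ} {i j k : Fin n} (hij : i < j) (hjk : j < k) (a : ℕ) (m : Mon n) :
    Term.toPoly (a, m + var hij + var hjk)
      = Term.toPoly (a, m) * (MvPolynomial.X (edge hij) * MvPolynomial.X (edge hjk)) ∧
    Term.toPoly (a, m + var (hij.trans hjk) + var hij) +
      (Term.toPoly (a, m + var (hij.trans hjk) + var hjk) +
        Term.toPoly (a + 1, m + var (hij.trans hjk)))
      = Term.toPoly (a, m) * (MvPolynomial.X (edge (hij.trans hjk)) *
        (MvPolynomial.X (edge hij) + MvPolynomial.X (edge hjk) +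
          MvPolynomial.C Polynomial.X)) := by
  have hadd (a : ℕ) (d : Mon n) (e : Edge n) :
      Term.toPoly (a, d + Finsupp.single e 1) = Term.toPoly (a, d) * MvPolynomial.X e := by
    rw [Term.toPoly, Term.toPoly, MvPolynomial.X, MvPolynomial.monomial_mul, mul_one]
  have hsucc (d : Mon n) :
      Term.toPoly (a + 1, d) = Term.toPoly (a, d) * MvPolynomial.C Polynomial.X := by
    rw [Term.toPoly, Term.toPoly, mul_comm, MvPolynomial.C_mul_monomial, ← pow_succ']
  simp only [hadd, hsucc]
  constructor <;> ring

theorem seriesSubst_step {n : ℕ} {S S' : Multiset (Term n)} (h : Step S S') :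
    seriesSubst n (S.map Term.toPoly).sum = seriesSubst n (S'.map Term.toPoly).sum := by
  cases h with
  | @reduce i j k hij hjk a m S =>
    have h1 : i.val < j.val := hij
    have h2 : j.val < k.val := hjk
    have h3 := k.isLt
    simp only [Multiset.map_add, Multiset.sum_add, Multiset.insert_eq_cons, Multiset.map_cons,
      Multiset.sum_cons, Multiset.map_singleton, Multiset.sum_singleton]
    rw [(toPoly_step hij hjk a m).1, (toPoly_step hij hjk a m).2, map_add, map_add, map_mul,
      map_mul, map_mul, map_mul, map_add, map_add, ← MvPolynomial.algebraMap_eq,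
      AlgHom.commutes]
    simp only [seriesSubst, MvPolynomial.aeval_X]
    rw [smul_geomSeries_relation _ (interval_ne_zero (by omega) h1)
      (interval_ne_zero (by omega) h2), interval_add _ h1 h2]

theorem seriesSubst_reduces {n : ℕ} {S S' : Multiset (Term n)}
    (h : Relation.ReflTransGen Step S S') :
    seriesSubst n (S.map Term.toPoly).sum = seriesSubst n (S'.map Term.toPoly).sum := by
  induction h with
  | refl => rfl
  | tail _ h ih => exact ih.trans (seriesSubst_step h)

theorem pushforward_seriesSubst_monomial {n : ℕ} {d : Mon n} (hd : nonalt d = ∅)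
    (c : Polynomial ℚ) :
    pushforward ascents finite_ascents_fiber (seriesSubst n (MvPolynomial.monomial d c))
      = MvPolynomial.aeval (fun i => (Polynomial.X : Polynomial ℚ) •
          geomSeries (Polynomial ℚ) (Finsupp.single i 1))
        (tSubst n (MvPolynomial.monomial d c)) := by
  rw [← mul_one c, ← smul_eq_mul, ← MvPolynomial.smul_monomial]
  simp only [map_smul]
  congr 1
  rw [seriesSubst, tSubst, MvPolynomial.aeval_monomial, MvPolynomial.aeval_monomial, map_one,
    map_one, one_mul, one_mul, Finsupp.prod, Finsupp.prod,
    pushforward_prod_pow ascents finite_ascents_fiber ascents_zero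
      -- Upward jumps are allowed exactly at the starts of edges of this term.
      (S := jumpCone {l | ∃ e ∈ d.support, e.1.1.val = l.val})
      (fun a ha b hb => ascents_add ha hb), map_prod]
  · refine Finset.prod_congr rfl fun e _ => ?_
    have hlt : e.1.1.val < e.1.2.val := e.2
    rw [map_pow, MvPolynomial.aeval_X, map_smul, pushforward_geomSeries,
      ascents_interval e.fst_lt hlt]
    · rw [ascents_interval e.fst_lt hlt]
      exact Finsupp.single_ne_zero.2 one_ne_zero
    · intro m
      rw [ascents_nsmul_interval e.fst_lt hlt, ascents_interval e.fst_lt hlt]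
  · rintro ⟨⟨i, j⟩, hij⟩ he
    refine (supportedIn_geomSeries (interval_mem_jumpCone ?_ ?_)).smul _
    · intro l hl
      exact ⟨_, he, hl.symm⟩
    -- An end of one edge that starts another would be a nonalternating vertex.
    · rintro l hl ⟨⟨⟨j', k⟩, hjk⟩, he', hl'⟩
      obtain rfl : j' = j := Fin.ext (hl'.trans hl)
      have : j' ∈ nonalt d := Finset.mem_filter.2 ⟨Finset.mem_univ _,
        ⟨i, Finset.mem_filter.2 ⟨Finset.mem_univ _, hij, he⟩⟩,
        ⟨k, Finset.mem_filter.2 ⟨Finset.mem_univ _, hjk, he'⟩⟩⟩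
      rw [hd] at this
      exact Finset.notMem_empty _ this

theorem pushforward_seriesSubst_sum {n : ℕ} {S : Multiset (Term n)}
    (hS : ∀ s ∈ S, nonalt s.2 = ∅) :
    pushforward ascents finite_ascents_fiber (seriesSubst n (S.map Term.toPoly).sum)
      = MvPolynomial.aeval (fun i => (Polynomial.X : Polynomial ℚ) •
          geomSeries (Polynomial ℚ) (Finsupp.single i 1))
        (tSubst n (S.map Term.toPoly).sum) := by
  induction S using Multiset.induction_on with
  | empty => simp
  | cons s S ih =>
    rw [Multiset.map_cons, Multiset.sum_cons]
    simp only [map_add]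
    rw [ih fun t ht => hS t (Multiset.mem_cons_of_mem ht), Term.toPoly,
      pushforward_seriesSubst_monomial (hS s (Multiset.mem_cons_self s S))]

/-- The reduced form of a monomial is unique after the substitution `x_{ij} = t_i`. -/
theorem tSubst_eq_of_isReducedForm {n : ℕ} {d : Mon n} {R R' : XPoly n}
    (hR : IsReducedForm d R) (hR' : IsReducedForm d R') : tSubst n R = tSubst n R' := by
  obtain ⟨S, hr, hi, rfl⟩ := hR
  obtain ⟨S', hr', hi', rfl⟩ := hR'
  refine aeval_geomSeries_injective (b := (Polynomial.X : Polynomial ℚ)) Polynomial.X_ne_zero ?_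
  -- Both evaluations are pushforwards of the same series, the image of `x ^ d` under `seriesSubst`.
  rw [← pushforward_seriesSubst_sum ((irreducible_iff S).1 hi),
    ← pushforward_seriesSubst_sum ((irreducible_iff S').1 hi'),
    ← seriesSubst_reduces hr, ← seriesSubst_reduces hr']

end SubdivisionAlgebra

theorem mainTheorem5 {n : ℕ} (T : SimpleGraph (Fin n)) (hT : T.IsTree)
    (hnc : SubdivisionAlgebra.Noncrossing T) :
    SubdivisionAlgebra.IsReducedForm (SubdivisionAlgebra.graphMon T) (SubdivisionAlgebra.crf T) ∧
    SubdivisionAlgebra.IsReducedForm (SubdivisionAlgebra.graphMon T)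
      (SubdivisionAlgebra.crfBack T) ∧
    ∀ R : SubdivisionAlgebra.XPoly n,
      SubdivisionAlgebra.IsReducedForm (SubdivisionAlgebra.graphMon T) R →
        SubdivisionAlgebra.tSubst n R = SubdivisionAlgebra.tSubst n (SubdivisionAlgebra.crf T) ∧
        SubdivisionAlgebra.tSubst n R =
          SubdivisionAlgebra.tSubst n (SubdivisionAlgebra.crfBack T) := by
  have h₁ := SubdivisionAlgebra.isReducedForm_topReduce (fun s h => s.min' h)
    (fun s h => s.min'_mem h) (SubdivisionAlgebra.graphMon T)
  have h₂ := SubdivisionAlgebra.isReducedForm_topReduce (fun s h => s.max' h)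
    (fun s h => s.max'_mem h) (SubdivisionAlgebra.graphMon T)
  exact ⟨h₁, h₂, fun R hR => ⟨SubdivisionAlgebra.tSubst_eq_of_isReducedForm hR h₁,
    SubdivisionAlgebra.tSubst_eq_of_isReducedForm hR h₂⟩⟩
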